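/- **Setting.** For $p\in(0,1)$ let $X_1,X_2,\dots$ be i.i.d. Bernoulli variables with parameter $p$, and let $U_1,U_2,\dots$ be i.i.d. uniform variables on $(0,1)$, independent of the $X_i$. A (possibly randomized) *simulation algorithm* is given by measurable stopping functions $\tau_i(x_1,u_1;\dots;x_i,u_i)\in\{0,1\}$ and measurable output functions $\gamma_i(x_1,u_1;\dots;x_i,u_i)\in\{0,1\}$, $i\ge 1$ (it is non-randomized if these do not depend on the $u_j$). It uses $N$ inputs, where $N$ is the least $i\ge1$ with $\tau_i(X_1,U_1;\dots;X_i,U_i)=1$ (and $N=\infty$ if there is none), and it outputs $Y=\gamma_N(X_1,U_1;\dots;X_N,U_N)$. It is a *Bernoulli factory* for a function $f:(0,1)\to(0,1)$ if for every $p\in(0,1)$ one has $N<\infty$ almost surely and $\Pr[Y=1]=f(p)$. It is *fast* if for every $p\in(0,1)$ there are $A>0$ and $\beta<1$ (possibly depending on $p$) such that $\Pr[N>n]\le A\beta^n$ for all $n$. Let $$f(p)=1-\sum_{k=1}^\infty c_k(1-p)^k\quad(0<p<1),\qquad c_k\ge 0,\quad \sum_{k=1}^\infty c_k=1,$$ and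 put $d_k=c_k/\bigl(1-\sum_{j=1}^{k-1}c_j\bigr)$. Consider the following *series algorithm*: at step $i=1,2,\dots$ take an input $X_i$, and let $V_i=1$ if $U_i<d_i$ and $V_i=0$ otherwise; if $V_i=1$ or $X_i=1$, output $Y=X_i$ and finish; otherwise go on to step $i+1$. (If the denominator of $d_k$ vanishes, $d_k$ is not needed, because the algorithm has finished before step $k$.) **Corollary.** Suppose that $\lim_{p\to0}f(p)/p=\infty$, and that $f'(p)=\Omega(f(p)/p)$ as $p\to0$, that is, there are $C_0,\delta_0>0$ with $f'(p)\ge C_0 f(p)/p$ for all $p\in(0,\delta_0)\cap(0,1)$. Then the series algorithm is asymptotically optimal as $p\to0$ among all fast (possibly randomized) Bernoulli factories for $f$: it is itself a fast Bernoulli factory for $f$, and for every fast Bernoulli factory for $f$ there are $C,\delta>0$ such that, for all $p\in(0,1)$ with $p<\delta$, its average number of inputs $\mathrm E[N]$ is at least $C$ times the average number of inputs of the series algorithm. More explicitly, the average number of inputs of the series algorithm is $f(p)/p$ for every $p\in(0,1)$, and every fast Bernoulli factory for $f$ satisfies, for some $C,\delta>0$, $$\mathrm E[N]\ \ge\ C\,\frac{f(p)}{p}\qquad\text{for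 all } p\in(0,1) \text{ with } p<\delta .$$ -/

import Mathlib

open MeasureTheory ProbabilityTheory Filter Topology
open scoped ENNReal

namespace BernoulliFactory

/-- The open interval `(0,1)` in which the unknown parameter `p` lies. -/
abbrev Param : Type := Set.Ioo (0 : ℝ) 1

/-- The parameter as an element of the closed unit interval. -/
def Param.toUnitInterval (p : Param) : unitInterval := ⟨p.1, p.2.1.le, p.2.2.le⟩

/-- A realization of the input sequence and of the randomizing sequence:
`ω i = (x_{i+1}, u_{i+1})`, where `true` and `false` stand for the values `1` and `0` of an input. -/
abbrev Sample : Type := ℕ → Bool × ℝ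

/-- The uniform distribution on `(0,1)`. -/
noncomputable def uniform01 : Measure ℝ := volume.restrict (Set.Ioo (0 : ℝ) 1)

/-- The joint law of the sequences `X` and `U`: all variables are independent, `X_i` is Bernoulli
with parameter `p`, and `U_i` is uniform on `(0,1)`. -/
noncomputable def law (p : Param) : Measure Sample :=
  Measure.infinitePi fun _ : ℕ =>
    (bernoulliMeasure true false p.toUnitInterval).prod uniform01

/-- The values `(x_1, u_1), …, (x_{n+1}, u_{n+1})`. -/
def pref (ω : Sample) (n : ℕ) : Fin (n + 1) → Bool × ℝ := fun i => ω i

/-- A (possibly randomized) simulation algorithm, given by measurable stopping functions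
and measurable output functions. `τ n` is the stopping function `τ_{n+1}` and `γ n` the output
function `γ_{n+1}`; both are applied to `(x_1, u_1), …, (x_{n+1}, u_{n+1})`. The algorithm is
non-randomized when these functions ignore the `u` components. -/
structure Simulation where
  τ : ∀ n : ℕ, (Fin (n + 1) → Bool × ℝ) → Bool
  γ : ∀ n : ℕ, (Fin (n + 1) → Bool × ℝ) → Bool
  measurable_τ : ∀ n, Measurable (τ n)
  measurable_γ : ∀ n, Measurable (γ n)

namespace Simulation

/-- The number `N` of inputs used: the smallest `i ≥ 1` such that `τ_i = 1`, and `∞` if there is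
no such `i`. -/
noncomputable def N (B : Simulation) (ω : Sample) : ℕ∞ :=
  ⨅ (n : ℕ) (_ : B.τ n (pref ω n) = true), ((n + 1 : ℕ) : ℕ∞)

/-- The event that the algorithm stops and its output is `Y = 1`. -/
def outputOne (B : Simulation) : Set Sample :=
  {ω | ∃ n : ℕ, B.N ω = ((n + 1 : ℕ) : ℕ∞) ∧ B.γ n (pref ω n) = true}

/-- `B` is a Bernoulli factory for `f : (0,1) → (0,1)`: for each `p`, it stops almost surely
and its output is Bernoulli with parameter `f p`. -/
def IsFactory (B : Simulation) (f : ℝ → ℝ) : Prop :=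
  ∀ p : Param, (∀ᵐ ω ∂law p, B.N ω ≠ ⊤) ∧ (law p).real B.outputOne = f p

/-- `B` is fast: for each `p` the distribution of `N` has an exponential tail. -/
def IsFast (B : Simulation) : Prop :=
  ∀ p : Param, ∃ A : ℝ, 0 < A ∧ ∃ β : ℝ, β < 1 ∧
    ∀ n : ℕ, (law p).real {ω | (n : ℕ∞) < B.N ω} ≤ A * β ^ n

/-- The average number of inputs `E[N]` when the parameter is `p`, as an element of `[0,∞]`. -/
noncomputable def EN (B : Simulation) (p : Param) : ℝ≥0∞ :=
  ∫⁻ ω, (B.N ω : ℝ≥0∞) ∂law p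

end Simulation

/-- `A` is asymptotically optimal as `p → 0` among all fast Bernoulli factories for `f`: it is one of
them, and the average number of inputs of any other one grows at least as fast as that of `A`. -/
def IsAsymptoticallyOptimal (A : Simulation) (f : ℝ → ℝ) : Prop :=
  A.IsFactory f ∧ A.IsFast ∧
    ∀ B : Simulation, B.IsFactory f → B.IsFast →
      ∃ C : ℝ, 0 < C ∧ ∃ δ : ℝ, 0 < δ ∧
        ∀ p : Param, (p : ℝ) < δ → ENNReal.ofReal C * A.EN p ≤ B.EN p

/-- On `(0,1)`, `f(p) = 1 - ∑_{k ≥ 1} c_k (1-p)^k` with `c_k ≥ 0` and `∑_{k ≥ 1} c_k = 1`.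
The value `c 0` is not used. -/
structure IsSeriesFor (c : ℕ → ℝ) (f : ℝ → ℝ) : Prop where
  nonneg : ∀ k : ℕ, 1 ≤ k → 0 ≤ c k
  sum_eq_one : HasSum (fun k : ℕ => c (k + 1)) 1
  eq_series : ∀ p ∈ Set.Ioo (0 : ℝ) 1, f p = 1 - ∑' k : ℕ, c (k + 1) * (1 - p) ^ (k + 1)

/-- `g(p) = Ω(h(p))` as `p → 0`, for functions on `(0,1)`. -/
def IsOmegaAtZero (g h : ℝ → ℝ) : Prop :=
  ∃ C : ℝ, 0 < C ∧ ∃ δ : ℝ, 0 < δ ∧ ∀ p ∈ Set.Ioo (0 : ℝ) 1, p < δ → C * h p ≤ g p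

/-- `d_k = c_k / (1 - ∑_{j=1}^{k-1} c_j)`. (Where the denominator vanishes the value is `0`; the
algorithm never reaches such a `k`, since it has stopped at the last nonzero coefficient.) -/
noncomputable def dCoeff (c : ℕ → ℝ) (k : ℕ) : ℝ :=
  c k / (1 - ∑ j ∈ Finset.Ico 1 k, c j)

open Classical in
/-- The algorithm which at step `i = 1, 2, …` takes an input `X_i`, sets `V_i = 1` if `U_i < d_i` and
`V_i = 0` otherwise, and, if `V_i` or `X_i` is `1`, outputs `Y = X_i` and finishes. -/
noncomputable def seriesAlgorithm (c : ℕ → ℝ) : Simulation where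
  τ n xu :=
    decide ((xu (Fin.last n)).2 < dCoeff c (n + 1)) || (xu (Fin.last n)).1
  γ n xu := (xu (Fin.last n)).1
  measurable_τ n := by
    have h1 : Measurable fun xu : Fin (n + 1) → Bool × ℝ => (xu (Fin.last n)).1 :=
      measurable_fst.comp (measurable_pi_apply _)
    have h2 : Measurable fun xu : Fin (n + 1) → Bool × ℝ => (xu (Fin.last n)).2 :=
      measurable_snd.comp (measurable_pi_apply _)
    have h3 : Measurable fun xu : Fin (n + 1) → Bool × ℝ =>
        decide ((xu (Fin.last n)).2 < dCoeff c (n + 1)) := by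
      apply measurable_to_bool
      have : (fun xu : Fin (n + 1) → Bool × ℝ =>
          decide ((xu (Fin.last n)).2 < dCoeff c (n + 1))) ⁻¹' {true} =
          {xu | (xu (Fin.last n)).2 < dCoeff c (n + 1)} := by
        ext xu; simp
      rw [this]
      exact measurableSet_lt h2 measurable_const
    exact (measurable_of_countable fun q : Bool × Bool => q.1 || q.2).comp (h3.prodMk h1)
  measurable_γ n := measurable_fst.comp (measurable_pi_apply _)

end BernoulliFactory

/-!
The upper bound is a direct computation. Let `r_n = 1 - c_1 - ⋯ - c_n`. The series algorithm passes
step `n + 1` when `X_{n+1} = 0` and `U_{n+1} ≥ d_{n+1}`, and `r_n (1 - d_{n+1}) = r_{n+1}`, so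
`Pr[N > n] = (1-p)^n r_n` (`law_real_lt_N_seriesAlgorithm`). This tail is exponential, and summation
by parts (`IsSeriesFor.hasSum_pow_mul_remainder`) gives `E[N] = ∑_n Pr[N > n] = f(p)/p`. The output
is `1` exactly when `X_N = 1`, which has probability `∑_n Pr[N > n] p = f(p)`.

The lower bound is an information inequality. Fix `p` and compare it with a second parameter `q`.
The likelihood ratio of the inputs used up to time `min N n` changes `law p` into `law q` on the
events known at that time (`Simulation.setLIntegral_stoppedRatio`), and the mean of its logarithm is
`-(∑_{i<n} Pr[N > i]) KL(p‖q)`, since the event `N > i` is independent of the next input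
(`Simulation.integral_log_stoppedRatio`). By `log x ≤ x - 1`, and letting `n → ∞`, the relative
entropy of the outputs is at most `E[N]` times that of single inputs. Bounding the former below by
`(√f(p) - √f(q))²` and the latter above by `(p - q)² / (q (1 - q))`
(`Simulation.sq_sqrt_sub_sqrt_le`), dividing by `(p - q)²` and letting `q → p` yields
`f'(p)² / (4 f(p)) ≤ E[N] / (p (1 - p))` (`Simulation.IsFactory.sq_deriv_le`). With
`f'(p) ≥ C₀ f(p)/p` this gives `E[N] ≥ (C₀² / 4) (1 - p) f(p)/p`. As `p` stays fixed in the
expectation, no regularity of `E[N]` in `p` enters. The hypothesis on `f'` also provides the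
differentiability of `f` near `0`, because `f > 0` and `deriv` vanishes where `f` is not
differentiable.
-/

namespace BernoulliFactory

/-! ### The law of the inputs and the number of inputs used -/

instance : IsProbabilityMeasure uniform01 := ⟨by simp [uniform01]⟩

/-- The joint law of one input `X_i` and its randomizing variable `U_i`. -/
noncomputable def inputLaw (p : Param) : Measure (Bool × ℝ) :=
  (bernoulliMeasure true false p.toUnitInterval).prod uniform01

instance (p : Param) : IsProbabilityMeasure (inputLaw p) := by
  unfold inputLaw; infer_instance

lemma law_eq (p : Param) : law p = Measure.infinitePi fun _ : ℕ => inputLaw p := rfl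

instance (p : Param) : IsProbabilityMeasure (law p) := by
  rw [law_eq]; infer_instance

/-- The `σ`-algebra of events determined by the first `n` pairs `(x_i, u_i)`. -/
abbrev prefixAlgebra (n : ℕ) : MeasurableSpace Sample :=
  MeasurableSpace.comap (Finset.range n).restrict inferInstance

lemma prefixAlgebra_le (n : ℕ) : prefixAlgebra n ≤ (inferInstance : MeasurableSpace Sample) :=
  Measurable.comap_le (Finset.measurable_restrict _)

lemma measurable_apply_prefixAlgebra {i n : ℕ} (h : i < n) :
    Measurable[prefixAlgebra n] fun ω : Sample => ω i := by
  have h1 : Measurable[prefixAlgebra n] ((Finset.range n).restrict (π := fun _ => Bool × ℝ)) :=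
    comap_measurable _
  exact (measurable_pi_apply (⟨i, Finset.mem_range.2 h⟩ : Finset.range n)).comp h1

lemma measurable_pref {i n : ℕ} (h : i < n) :
    Measurable[prefixAlgebra n] fun ω : Sample => pref ω i := by
  refine @measurable_pi_lambda _ _ _ (prefixAlgebra n) _ _ fun j => ?_
  exact measurable_apply_prefixAlgebra (by omega)

namespace Simulation

variable (B : Simulation)

lemma lt_N_iff (n : ℕ) (ω : Sample) :
    (n : ℕ∞) < B.N ω ↔ ∀ i < n, B.τ i (pref ω i) = false := by
  rw [N]
  constructor
  · intro h i hi
    by_contra hτ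
    have h1 : (⨅ (n : ℕ) (_ : B.τ n (pref ω n) = true), ((n + 1 : ℕ) : ℕ∞)) ≤ ((i + 1 : ℕ) : ℕ∞) :=
      iInf₂_le i (by simpa using hτ)
    have h2 := h.trans_le h1
    rw [Nat.cast_lt] at h2
    omega
  · intro h
    refine lt_of_lt_of_le (b := ((n + 1 : ℕ) : ℕ∞)) (by rw [Nat.cast_lt]; omega) ?_
    refine le_iInf₂ fun i hi => ?_
    rw [Nat.cast_le]
    by_contra hlt
    have := h i (by omega)
    simp [this] at hi

lemma measurableSet_lt_N {m n : ℕ} (hmn : n ≤ m) :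
    MeasurableSet[prefixAlgebra m] {ω | (n : ℕ∞) < B.N ω} := by
  have : {ω | (n : ℕ∞) < B.N ω} =
      ⋂ i ∈ Finset.range n, (fun ω => B.τ i (pref ω i)) ⁻¹' {false} := by
    ext ω; simp [lt_N_iff]
  rw [this]
  refine @Finset.measurableSet_biInter _ _ (prefixAlgebra m) _ _ fun i hi => ?_
  exact ((B.measurable_τ i).comp
    (measurable_pref ((Finset.mem_range.1 hi).trans_le hmn))) (.singleton _)

lemma N_eq_succ_iff_lt (n : ℕ) (ω : Sample) :
    B.N ω = ((n + 1 : ℕ) : ℕ∞) ↔ (n : ℕ∞) < B.N ω ∧ ¬ ((n + 1 : ℕ) : ℕ∞) < B.N ω := by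
  induction B.N ω using ENat.recTopCoe with
  | top => simpa using ENat.top_ne_natCast (n + 1)
  | coe a => simp only [Nat.cast_lt, Nat.cast_inj]; omega

lemma N_eq_succ_iff (n : ℕ) (ω : Sample) :
    B.N ω = ((n + 1 : ℕ) : ℕ∞) ↔ (n : ℕ∞) < B.N ω ∧ B.τ n (pref ω n) = true := by
  have h1 := B.lt_N_iff n ω
  have h2 := B.lt_N_iff (n + 1) ω
  rw [N_eq_succ_iff_lt]
  refine and_congr_right fun h => ?_
  have h4 := h1.1 h
  rw [h2]
  constructor
  · intro hn
    by_contra hf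
    refine hn fun i hi => ?_
    rcases Nat.lt_succ_iff_lt_or_eq.1 hi with h | rfl
    · exact h4 i h
    · simpa using hf
  · intro ht hall
    simp [hall n (Nat.lt_succ_self n)] at ht

lemma measurableSet_N_eq_succ (n : ℕ) :
    MeasurableSet[prefixAlgebra (n + 1)] {ω | B.N ω = ((n + 1 : ℕ) : ℕ∞)} := by
  have h : {ω | B.N ω = ((n + 1 : ℕ) : ℕ∞)} =
      {ω | (n : ℕ∞) < B.N ω} \ {ω | ((n + 1 : ℕ) : ℕ∞) < B.N ω} := by
    ext ω; exact B.N_eq_succ_iff_lt n ω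
  rw [h]
  exact @MeasurableSet.diff _ (prefixAlgebra (n + 1)) _ _ (B.measurableSet_lt_N n.le_succ)
    (B.measurableSet_lt_N le_rfl)

lemma measurableSet_N_eq_inter_outputOne (n : ℕ) :
    MeasurableSet[prefixAlgebra (n + 1)]
      (B.outputOne ∩ {ω | B.N ω = ((n + 1 : ℕ) : ℕ∞)}) := by
  have h : B.outputOne ∩ {ω | B.N ω = ((n + 1 : ℕ) : ℕ∞)} =
      {ω | B.N ω = ((n + 1 : ℕ) : ℕ∞)} ∩ (fun ω => B.γ n (pref ω n)) ⁻¹' {true} := by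
    ext ω
    simp only [outputOne, Set.mem_inter_iff, Set.mem_ofPred_eq, Set.mem_preimage,
      Set.mem_singleton_iff]
    constructor
    · rintro ⟨⟨m, hm, hγ⟩, hn⟩
      have : m = n := by
        have := hm.symm.trans hn
        rw [Nat.cast_inj] at this; omega
      exact ⟨hn, this ▸ hγ⟩
    · rintro ⟨hn, hγ⟩
      exact ⟨⟨n, hn, hγ⟩, hn⟩
  rw [h]
  exact @MeasurableSet.inter _ (prefixAlgebra (n + 1)) _ _ (B.measurableSet_N_eq_succ n)
    (((B.measurable_γ n).comp (measurable_pref (Nat.lt_succ_self n))) (.singleton _))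

lemma outputOne_eq_iUnion :
    B.outputOne = ⋃ n : ℕ, B.outputOne ∩ {ω | B.N ω = ((n + 1 : ℕ) : ℕ∞)} := by
  ext ω
  simp only [outputOne, Set.mem_iUnion, Set.mem_inter_iff, Set.mem_ofPred_eq]
  constructor
  · rintro ⟨n, hn, hγ⟩; exact ⟨n, ⟨n, hn, hγ⟩, hn⟩
  · rintro ⟨n, h, -⟩; exact h

lemma measurableSet_outputOne : MeasurableSet B.outputOne := by
  rw [outputOne_eq_iUnion]
  exact .iUnion fun n => prefixAlgebra_le _ _ (B.measurableSet_N_eq_inter_outputOne n)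

lemma measurableSet_lt_N_ambient (n : ℕ) : MeasurableSet {ω | (n : ℕ∞) < B.N ω} :=
  prefixAlgebra_le _ _ (B.measurableSet_lt_N le_rfl)

lemma coe_N_eq_tsum (ω : Sample) :
    (B.N ω : ℝ≥0∞) = ∑' n : ℕ, {ω | (n : ℕ∞) < B.N ω}.indicator 1 ω := by
  simp only [Set.indicator_apply, Set.mem_ofPred_eq, Pi.one_apply]
  induction B.N ω using ENat.recTopCoe with
  | top => simp
  | coe a =>
    rw [tsum_eq_sum (s := Finset.range a) (by intro b hb; simpa using hb)]
    rw [Finset.sum_congr rfl (g := fun _ => (1 : ℝ≥0∞)) (by intro i hi; simpa using hi)]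
    simp

/-- The tail-sum formula `E[N] = ∑_{n ≥ 0} Pr[N > n]`. -/
lemma EN_eq_tsum (p : Param) : B.EN p = ∑' n : ℕ, law p {ω | (n : ℕ∞) < B.N ω} := by
  simp only [EN, coe_N_eq_tsum]
  rw [lintegral_tsum fun n =>
    (measurable_one.indicator (B.measurableSet_lt_N_ambient n)).aemeasurable]
  exact tsum_congr fun n => lintegral_indicator_one (B.measurableSet_lt_N_ambient n)

end Simulation

/-- The first `n` pairs are independent of the pair with index `n`. -/
lemma indepFun_restrict_apply (p : Param) (n : ℕ) :
    IndepFun ((Finset.range n).restrict (π := fun _ => Bool × ℝ)) (fun ω : Sample => ω n)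
      (law p) := by
  have h : iIndepFun (fun (i : ℕ) (ω : Sample) => ω i) (law p) := by
    rw [law_eq]
    exact iIndepFun_infinitePi (X := fun _ x => x) (fun _ => measurable_id)
  have h2 := h.indepFun_finset (Finset.range n) {n} (by simp) (fun i => measurable_pi_apply i)
  exact h2.comp (φ := id) (ψ := fun x : ({n} : Finset ℕ) → Bool × ℝ => x ⟨n, by simp⟩)
    measurable_id (measurable_pi_apply (⟨n, by simp⟩ : ({n} : Finset ℕ)))

lemma inputLaw_true (p : Param) : (inputLaw p).real {x | x.1 = true} = p := by
  have h : {x : Bool × ℝ | x.1 = true} = {true} ×ˢ Set.univ := by ext; simp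
  rw [h, inputLaw, measureReal_prod_prod]
  simp [Param.toUnitInterval]

/-! ### Likelihood ratios and change of measure -/

/-- The likelihood ratio of a single input: the density of the Bernoulli law with parameter `q`
relative to that with parameter `p`. -/
noncomputable def ratio (p q : Param) (b : Bool) : ℝ := if b then q / p else (1 - q) / (1 - p)

lemma ratio_pos (p q : Param) (b : Bool) : 0 < ratio p q b := by
  have h1 := p.2.1; have h2 := p.2.2; have h3 := q.2.1; have h4 := q.2.2
  unfold ratio
  split_ifs
  · exact div_pos h3 h1
  · exact div_pos (by linarith) (by linarith)

lemma inputLaw_withDensity (p q : Param) :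
    (inputLaw p).withDensity (fun x => ENNReal.ofReal (ratio p q x.1)) = inputLaw q := by
  have h1 := p.2.1; have h2 := p.2.2; have h3 := q.2.1; have h4 := q.2.2
  have hb : (bernoulliMeasure true false p.toUnitInterval).withDensity
      (fun b => ENNReal.ofReal (ratio p q b)) = bernoulliMeasure true false q.toUnitInterval := by
    refine Measure.ext_of_singleton fun b => ?_
    rw [withDensity_apply _ (.singleton _), Measure.restrict_singleton, lintegral_smul_measure,
      lintegral_dirac]
    have ht (p : Param) : (unitInterval.toNNReal p.toUnitInterval : ℝ≥0∞) = ENNReal.ofReal p := by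
      rw [ENNReal.ofReal_eq_coe_nnreal p.2.1.le]; rfl
    have hf (p : Param) : (unitInterval.toNNReal (unitInterval.symm p.toUnitInterval) : ℝ≥0∞) =
        ENNReal.ofReal (1 - p) := by
      rw [ENNReal.ofReal_eq_coe_nnreal (by linarith [p.2.2])]; rfl
    cases b
    · simp only [measurableSet_singleton, Set.mem_singleton_iff, Bool.true_eq_false,
        not_false_eq_true, bernoulliMeasure_apply_of_notMem_of_mem, hf, ratio, smul_eq_mul]
      rw [← ENNReal.ofReal_mul (by linarith)]
      congr 1
      simp
      field_simp [show (1 - (p : ℝ)) ≠ 0 by linarith]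
    · simp only [measurableSet_singleton, Set.mem_singleton_iff, Bool.false_eq_true,
        not_false_eq_true, bernoulliMeasure_apply_of_mem_of_notMem, ht, ratio, smul_eq_mul]
      rw [← ENNReal.ofReal_mul (by linarith)]
      congr 1
      simp
      field_simp
  rw [inputLaw, inputLaw, ← hb, prod_withDensity_left (measurable_of_countable _)]

lemma measurable_ratio (p q : Param) (i : ℕ) :
    Measurable fun ω : Sample => ratio p q (ω i).1 :=
  (measurable_of_countable (ratio p q)).comp (measurable_fst.comp (measurable_pi_apply i))

/-- The expected log-likelihood ratio of one input; it is minus the relative entropy of the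
Bernoulli distributions with parameters `p` and `q`. -/
noncomputable def logRatioMean (p q : Param) : ℝ :=
  p * Real.log (q / p) + (1 - p) * Real.log ((1 - q) / (1 - p))

/-- The relative entropy of two Bernoulli distributions is at most their `χ²`-divergence. -/
lemma neg_logRatioMean_le (p q : Param) :
    -logRatioMean p q ≤ (p - q : ℝ) ^ 2 / (q * (1 - q)) := by
  have h1 := p.2.1; have h2 := p.2.2; have h3 := q.2.1; have h4 := q.2.2
  have h5 : 0 < 1 - (p : ℝ) := by linarith
  have h6 : 0 < 1 - (q : ℝ) := by linarith
  have e1 : -Real.log (q / p) ≤ p / q - 1 := by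
    rw [← Real.log_inv, inv_div]; exact Real.log_le_sub_one_of_pos (div_pos h1 h3)
  have e2 : -Real.log ((1 - q) / (1 - p)) ≤ (1 - p) / (1 - q) - 1 := by
    rw [← Real.log_inv, inv_div]; exact Real.log_le_sub_one_of_pos (div_pos h5 h6)
  have e3 := mul_le_mul_of_nonneg_left e1 h1.le
  have e4 := mul_le_mul_of_nonneg_left e2 h5.le
  have e5 : (p : ℝ) * (p / q - 1) + (1 - p) * ((1 - p) / (1 - q) - 1) =
      (p - q : ℝ) ^ 2 / (q * (1 - q)) := by
    field_simp; ring
  rw [← e5, logRatioMean]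
  linarith

/-- The likelihood ratio of the first `n` inputs transforms `law p` into `law q` on the events
determined by these inputs. -/
lemma setLIntegral_prod_ratio (p q : Param) (n : ℕ) {E : Set Sample}
    (hE : MeasurableSet[prefixAlgebra n] E) :
    ∫⁻ ω in E, ENNReal.ofReal (∏ i ∈ Finset.range n, ratio p q (ω i).1) ∂law p = law q E := by
  obtain ⟨S, hS, rfl⟩ := hE
  have hrest : Measurable ((Finset.range n).restrict (π := fun _ => Bool × ℝ)) :=
    Finset.measurable_restrict _
  -- Both sides are the values at `S` of measures on the first `n` coordinates, which are compared
  -- on boxes.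
  suffices h : Measure.pi (fun _ : Finset.range n => inputLaw q) =
      ((law p).withDensity fun ω => ENNReal.ofReal (∏ i ∈ Finset.range n, ratio p q (ω i).1)).map
        (Finset.range n).restrict by
    have h' := congrArg (fun ν => ν S) h
    simp only [Measure.map_apply hrest hS] at h'
    rw [withDensity_apply _ (hrest hS)] at h'
    rw [← h', ← Measure.map_apply hrest hS, law_eq, Measure.infinitePi_map_restrict]
  refine Measure.pi_eq fun s hs => ?_
  classical
  set t : ℕ → Set (Bool × ℝ) := fun i => if h : i ∈ Finset.range n then s ⟨i, h⟩ else Set.univ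
    with ht
  have htm (i : ℕ) : MeasurableSet (t i) := by
    simp only [ht]; split_ifs with h
    · exact hs _
    · exact .univ
  have hpre : (Finset.range n).restrict (π := fun _ => Bool × ℝ) ⁻¹' Set.univ.pi s =
      {ω | ∀ i ∈ Finset.range n, ω i ∈ t i} := by
    ext ω
    simp only [Set.mem_preimage, Set.mem_pi, Set.mem_univ, forall_true_left, Set.mem_ofPred_eq, ht]
    constructor
    · intro h i hi
      rw [dif_pos hi]; exact h ⟨i, hi⟩
    · intro h i
      have := h i.1 i.2
      rwa [dif_pos i.2] at this
  have hmeas : MeasurableSet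
      ((Finset.range n).restrict (π := fun _ => Bool × ℝ) ⁻¹' Set.univ.pi s) :=
    hrest (.univ_pi hs)
  rw [Measure.map_apply hrest (.univ_pi hs), withDensity_apply _ hmeas, ← lintegral_indicator hmeas]
  set g : ℕ → Bool × ℝ → ℝ≥0∞ :=
    fun i => (t i).indicator fun x => ENNReal.ofReal (ratio p q x.1) with hg
  have hgm (i : ℕ) : Measurable (g i) :=
    ((measurable_of_countable fun b => ENNReal.ofReal (ratio p q b)).comp measurable_fst).indicator
      (htm i)
  have hprod (ω : Sample) : ((Finset.range n).restrict (π := fun _ => Bool × ℝ) ⁻¹'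
      Set.univ.pi s).indicator
        (fun ω => ENNReal.ofReal (∏ i ∈ Finset.range n, ratio p q (ω i).1)) ω =
      ∏ i ∈ Finset.range n, g i (ω i) := by
    rw [hpre]
    by_cases h : ∀ i ∈ Finset.range n, ω i ∈ t i
    · rw [Set.indicator_of_mem (by exact h),
        ENNReal.ofReal_prod_of_nonneg fun i _ => (ratio_pos p q _).le]
      exact Finset.prod_congr rfl fun i hi => by
        simp only [hg, Set.indicator_of_mem (h i hi)]
    · rw [Set.indicator_of_notMem (by exact h)]
      push Not at h
      obtain ⟨i, hi, hit⟩ := h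
      exact (Finset.prod_eq_zero hi (Set.indicator_of_notMem hit _)).symm
  simp only [hprod]
  have hindep : iIndepFun (fun (i : ℕ) (ω : Sample) => g i (ω i)) (law p) := by
    rw [law_eq]; exact iIndepFun_infinitePi hgm
  have hint := lintegral_prod_eq_prod_lintegral_of_indepFun (Finset.range n)
    (fun i (ω : Sample) => g i (ω i)) hindep fun i => (hgm i).comp (measurable_pi_apply i)
  refine hint.trans ?_
  rw [← Finset.prod_coe_sort]
  refine Finset.prod_congr rfl fun i _ => ?_
  have hmp : MeasurePreserving (fun ω : Sample => ω i) (law p) (inputLaw p) := by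
    rw [law_eq]; exact measurePreserving_eval_infinitePi _ _
  rw [hmp.lintegral_comp (hgm i), lintegral_indicator (htm _), ← withDensity_apply _ (htm _),
    inputLaw_withDensity]
  simp [ht, Finset.mem_range.1 i.2]

/-- The pair with index `n` is independent of the events determined by the `n` earlier ones. -/
lemma law_real_inter_apply (p : Param) (n : ℕ) {E : Set Sample}
    (hE : MeasurableSet[prefixAlgebra n] E) {T : Set (Bool × ℝ)} (hT : MeasurableSet T) :
    (law p).real (E ∩ {ω | ω n ∈ T}) = (law p).real E * (inputLaw p).real T := by
  obtain ⟨S, hS, rfl⟩ := hE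
  have h := (indepFun_restrict_apply p n).measure_inter_preimage_eq_mul S T hS hT
  have hmp : MeasurePreserving (fun ω : Sample => ω n) (law p) (inputLaw p) := by
    rw [law_eq]; exact measurePreserving_eval_infinitePi _ _
  rw [hmp.measure_preimage hT.nullMeasurableSet] at h
  simp only [Measure.real, ← ENNReal.toReal_mul]
  exact congrArg _ h

/-! ### The entropy inequality for a stopped algorithm -/

namespace Simulation

variable (B : Simulation)

/-- A measure is split according to the value of the bounded stopping time `min N n`. -/
lemma measure_eq_sum_N_eq_add (μ : Measure Sample) (A : Set Sample) (n : ℕ) :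
    μ A = ∑ k ∈ Finset.range n, μ (A ∩ {ω | B.N ω = ((k + 1 : ℕ) : ℕ∞)}) +
      μ (A ∩ {ω | (n : ℕ∞) < B.N ω}) := by
  induction n with
  | zero =>
    have : {ω | ((0 : ℕ) : ℕ∞) < B.N ω} = Set.univ := by
      ext ω; simp only [Set.mem_ofPred_eq, Set.mem_univ, iff_true, lt_N_iff]; simp
    simp only [this]
    simp
  | succ n ih =>
    rw [ih, Finset.sum_range_succ, add_assoc]
    congr 1
    rw [← measure_inter_add_sdiff (A ∩ {ω | (n : ℕ∞) < B.N ω})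
      (B.measurableSet_lt_N_ambient (n + 1)), add_comm]
    congr 2
    · ext ω
      simp only [Set.mem_sdiff, Set.mem_inter_iff, Set.mem_ofPred_eq, and_assoc,
        N_eq_succ_iff_lt]
    · ext ω
      simp only [Set.mem_inter_iff, Set.mem_ofPred_eq, and_assoc]
      refine and_congr_right fun _ => and_iff_right_of_imp fun h => lt_trans ?_ h
      rw [Nat.cast_lt]; omega

/-- The likelihood ratio of the inputs used by `B` up to step `n`. -/
noncomputable def stoppedRatio (p q : Param) (n : ℕ) (ω : Sample) : ℝ :=
  ∏ i ∈ Finset.range n, if (i : ℕ∞) < B.N ω then ratio p q (ω i).1 else 1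

lemma stoppedRatio_pos (p q : Param) (n : ℕ) (ω : Sample) : 0 < B.stoppedRatio p q n ω :=
  Finset.prod_pos fun i _ => by split_ifs; exacts [ratio_pos p q _, one_pos]

lemma measurable_stoppedRatio (p q : Param) (n : ℕ) : Measurable (B.stoppedRatio p q n) :=
  Finset.measurable_prod _ fun i _ =>
    Measurable.ite (B.measurableSet_lt_N_ambient i) (measurable_ratio p q i) measurable_const

/-- Change of measure up to the stopping time `min N n`, on the events of its `σ`-algebra. The
hypotheses `heq` and `hgt` express that `A` belongs to this `σ`-algebra. -/
lemma setLIntegral_stoppedRatio (p q : Param) (n : ℕ) {A : Set Sample} (hA : MeasurableSet A)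
    (heq : ∀ k < n, MeasurableSet[prefixAlgebra (k + 1)] (A ∩ {ω | B.N ω = ((k + 1 : ℕ) : ℕ∞)}))
    (hgt : MeasurableSet[prefixAlgebra n] (A ∩ {ω | (n : ℕ∞) < B.N ω})) :
    ∫⁻ ω in A, ENNReal.ofReal (B.stoppedRatio p q n ω) ∂law p = law q A := by
  rw [← withDensity_apply _ hA, B.measure_eq_sum_N_eq_add _ A n,
    B.measure_eq_sum_N_eq_add (law q) A n]
  congr 1
  · refine Finset.sum_congr rfl fun k hk => ?_
    have hk' := Finset.mem_range.1 hk
    have hm := prefixAlgebra_le _ _ (heq k hk')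
    rw [withDensity_apply _ hm, ← setLIntegral_prod_ratio p q _ (heq k hk')]
    refine setLIntegral_congr_fun hm fun ω hω => ?_
    have hN : B.N ω = ((k + 1 : ℕ) : ℕ∞) := hω.2
    simp only [stoppedRatio, hN, Nat.cast_lt]
    congr 1
    rw [← Finset.prod_filter]
    congr 1
    ext i; simp only [Finset.mem_filter, Finset.mem_range]; omega
  · have hm := prefixAlgebra_le _ _ hgt
    rw [withDensity_apply _ hm, ← setLIntegral_prod_ratio p q _ hgt]
    refine setLIntegral_congr_fun hm fun ω hω => ?_
    have hN : (n : ℕ∞) < B.N ω := hω.2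
    simp only [stoppedRatio]
    congr 1
    refine Finset.prod_congr rfl fun i hi => if_pos (lt_trans ?_ hN)
    rw [Nat.cast_lt]; exact Finset.mem_range.1 hi

lemma integrable_stoppedRatio (p q : Param) (n : ℕ) :
    Integrable (B.stoppedRatio p q n) (law p) := by
  refine ⟨(B.measurable_stoppedRatio p q n).aestronglyMeasurable, ?_⟩
  rw [hasFiniteIntegral_iff_ofReal (.of_forall fun ω => (B.stoppedRatio_pos p q n ω).le)]
  have h := B.setLIntegral_stoppedRatio p q n MeasurableSet.univ
    (fun k _ => by simpa using B.measurableSet_N_eq_succ k)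
    (by simpa using B.measurableSet_lt_N (le_refl n))
  rw [Measure.restrict_univ] at h
  simp [h]

lemma setIntegral_stoppedRatio (p q : Param) (n : ℕ) {A : Set Sample} (hA : MeasurableSet A)
    (heq : ∀ k < n, MeasurableSet[prefixAlgebra (k + 1)] (A ∩ {ω | B.N ω = ((k + 1 : ℕ) : ℕ∞)}))
    (hgt : MeasurableSet[prefixAlgebra n] (A ∩ {ω | (n : ℕ∞) < B.N ω})) :
    ∫ ω in A, B.stoppedRatio p q n ω ∂law p = (law q).real A := by
  rw [integral_eq_lintegral_of_nonneg_ae (.of_forall fun ω => (B.stoppedRatio_pos p q n ω).le)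
    (B.measurable_stoppedRatio p q n).aestronglyMeasurable,
    B.setLIntegral_stoppedRatio p q n hA heq hgt, Measure.real]

/-- Wald's identity for the log-likelihood ratio: each term contributes only while `N > i`, an event
that is independent of the input with index `i`. -/
lemma integral_log_stoppedRatio (p q : Param) (n : ℕ) :
    Integrable (fun ω => Real.log (B.stoppedRatio p q n ω)) (law p) ∧
    ∫ ω, Real.log (B.stoppedRatio p q n ω) ∂law p =
      (∑ i ∈ Finset.range n, (law p).real {ω | (i : ℕ∞) < B.N ω}) * logRatioMean p q := by
  have hT (b : Bool) : MeasurableSet {x : Bool × ℝ | x.1 = b} := measurable_fst (.singleton b)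
  have hE (i : ℕ) (b : Bool) :
      MeasurableSet ({ω | (i : ℕ∞) < B.N ω} ∩ {ω : Sample | ω i ∈ {x : Bool × ℝ | x.1 = b}}) :=
    (B.measurableSet_lt_N_ambient i).inter (measurable_pi_apply i (hT b))
  have hlog : (fun ω => Real.log (B.stoppedRatio p q n ω)) = fun ω =>
      ∑ i ∈ Finset.range n,
        (({ω | (i : ℕ∞) < B.N ω} ∩ {ω : Sample | ω i ∈ {x : Bool × ℝ | x.1 = true}}).indicator
            (fun _ => Real.log (q / p)) ω +
          ({ω | (i : ℕ∞) < B.N ω} ∩ {ω : Sample | ω i ∈ {x : Bool × ℝ | x.1 = false}}).indicator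
            (fun _ => Real.log ((1 - q) / (1 - p))) ω) := by
    ext ω
    rw [stoppedRatio, Real.log_prod fun i _ => by
      split_ifs; exacts [(ratio_pos p q _).ne', one_ne_zero]]
    refine Finset.sum_congr rfl fun i _ => ?_
    by_cases h : (i : ℕ∞) < B.N ω <;> cases hb : (ω i).1 <;>
      simp [h, hb, ratio]
  have hint (i : ℕ) (b : Bool) (r : ℝ) : Integrable
      (({ω | (i : ℕ∞) < B.N ω} ∩ {ω : Sample | ω i ∈ {x : Bool × ℝ | x.1 = b}}).indicator
        (fun _ => r)) (law p) :=
    (integrable_const r).indicator (hE i b)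
  have hfalse : (inputLaw p).real {x | x.1 = false} = 1 - p := by
    have h : {x : Bool × ℝ | x.1 = false} = {x | x.1 = true}ᶜ := by ext; simp
    rw [h, probReal_compl_eq_one_sub (hT true), inputLaw_true]
  rw [hlog]
  refine ⟨integrable_finsetSum _ fun i _ => (hint i true _).add (hint i false _), ?_⟩
  refine (integral_finsetSum _ fun i _ => (hint i true _).add (hint i false _)).trans ?_
  rw [Finset.sum_mul]
  refine Finset.sum_congr rfl fun i _ => ?_
  rw [integral_add' (hint i true _) (hint i false _), integral_indicator_const _ (hE i true),
    integral_indicator_const _ (hE i false),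
    law_real_inter_apply p i (B.measurableSet_lt_N le_rfl) (hT true),
    law_real_inter_apply p i (B.measurableSet_lt_N le_rfl) (hT false), inputLaw_true, hfalse,
    logRatioMean]
  simp only [smul_eq_mul]
  ring

/-- The event that `B` stops within `n` steps and outputs `1`. -/
def outputOneBy (n : ℕ) : Set Sample := B.outputOne \ {ω | (n : ℕ∞) < B.N ω}

lemma measurableSet_outputOneBy (n : ℕ) : MeasurableSet (B.outputOneBy n) :=
  B.measurableSet_outputOne.diff (B.measurableSet_lt_N_ambient n)

lemma setIntegral_stoppedRatio_outputOneBy (p q : Param) (n : ℕ) :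
    ∫ ω in B.outputOneBy n, B.stoppedRatio p q n ω ∂law p = (law q).real (B.outputOneBy n) := by
  refine B.setIntegral_stoppedRatio p q n (B.measurableSet_outputOneBy n) (fun k hk => ?_) ?_
  · have : B.outputOneBy n ∩ {ω | B.N ω = ((k + 1 : ℕ) : ℕ∞)} =
        B.outputOne ∩ {ω | B.N ω = ((k + 1 : ℕ) : ℕ∞)} := by
      ext ω
      simp only [outputOneBy, Set.mem_inter_iff, Set.mem_sdiff, Set.mem_ofPred_eq, and_assoc]
      refine and_congr_right fun _ => and_iff_right_of_imp fun h => ?_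
      rw [h, Nat.cast_lt]; omega
    rw [this]; exact B.measurableSet_N_eq_inter_outputOne k
  · have : B.outputOneBy n ∩ {ω | (n : ℕ∞) < B.N ω} = ∅ := by
      rw [outputOneBy]; exact Set.sdiff_inter_self
    rw [this]; exact @MeasurableSet.empty _ (prefixAlgebra n)

lemma tendsto_law_outputOneBy (p : Param) :
    Tendsto (fun n => (law p).real (B.outputOneBy n)) atTop (𝓝 ((law p).real B.outputOne)) := by
  have hmono : Monotone B.outputOneBy := fun m n hmn ω hω =>
    ⟨hω.1, fun h => hω.2 <| by
      rw [Set.mem_ofPred_eq] at h ⊢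
      exact lt_of_le_of_lt (Nat.cast_le.2 hmn) h⟩
  have hU : ⋃ n, B.outputOneBy n = B.outputOne := by
    refine Set.Subset.antisymm (Set.iUnion_subset fun n => Set.sdiff_subset) fun ω hω => ?_
    obtain ⟨n, hn, -⟩ := id hω
    refine Set.mem_iUnion.2 ⟨n + 1, hω, ?_⟩
    simp [hn]
  have h := tendsto_measure_iUnion_atTop (μ := law p) hmono
  rw [hU] at h
  exact (ENNReal.tendsto_toReal (measure_ne_top _ _)).comp h

/-- The variational form of the entropy inequality for the inputs used up to step `n`, with the test
function that is `log t` when the output is `1` within `n` steps and `log s` otherwise. The numbers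
`s` and `t` are arbitrary here, because their optimal values may be undefined for finite `n`. -/
lemma entropy_le_of_truncated (p q : Param) (n : ℕ) {s t : ℝ} (hs : 0 < s) (ht : 0 < t) :
    (law p).real (B.outputOneBy n) * Real.log t +
        (1 - (law p).real (B.outputOneBy n)) * Real.log s + 1 -
        t * (law q).real (B.outputOneBy n) - s * (1 - (law q).real (B.outputOneBy n)) ≤
      (∑ i ∈ Finset.range n, (law p).real {ω | (i : ℕ∞) < B.N ω}) * -logRatioMean p q := by
  set A := B.outputOneBy n
  have hAm : MeasurableSet A := B.measurableSet_outputOneBy n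
  obtain ⟨hli, hlog⟩ := B.integral_log_stoppedRatio p q n
  have hM := B.integrable_stoppedRatio p q n
  have hAint := B.setIntegral_stoppedRatio_outputOneBy p q n
  have hone := B.setIntegral_stoppedRatio p q n MeasurableSet.univ
    (fun k _ => by simpa using B.measurableSet_N_eq_succ k)
    (by simpa using B.measurableSet_lt_N (le_refl n))
  rw [Measure.restrict_univ, probReal_univ] at hone
  have hcint : ∫ ω in Aᶜ, B.stoppedRatio p q n ω ∂law p = 1 - (law q).real A := by
    have := integral_add_compl hAm hM
    linarith
  have hI (C : Set Sample) (hC : MeasurableSet C) (r : ℝ) :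
      Integrable (C.indicator fun _ : Sample => r) (law p) := (integrable_const r).indicator hC
  have hJ (C : Set Sample) (hC : MeasurableSet C) (r : ℝ) :
      Integrable (fun ω => r * C.indicator (B.stoppedRatio p q n) ω) (law p) :=
    (hM.indicator hC).const_mul r
  -- Pointwise this is `log x ≤ x - 1` for `x` the likelihood ratio times `t` or `s`.
  have hpt (ω : Sample) : Real.log (B.stoppedRatio p q n ω) +
      (A.indicator (fun _ => Real.log t) ω + Aᶜ.indicator (fun _ => Real.log s) ω) ≤
      (t * A.indicator (B.stoppedRatio p q n) ω + s * Aᶜ.indicator (B.stoppedRatio p q n) ω) -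
        1 := by
    have hpos := B.stoppedRatio_pos p q n ω
    by_cases h : ω ∈ A
    · have := Real.log_le_sub_one_of_pos (mul_pos ht hpos)
      rw [Real.log_mul ht.ne' hpos.ne'] at this
      simp [h]; linarith
    · have := Real.log_le_sub_one_of_pos (mul_pos hs hpos)
      rw [Real.log_mul hs.ne' hpos.ne'] at this
      simp [h]; linarith
  have hmono := integral_mono (μ := law p)
    (hli.add ((hI A hAm (Real.log t)).add (hI Aᶜ hAm.compl (Real.log s))))
    (((hJ A hAm t).add (hJ Aᶜ hAm.compl s)).sub (integrable_const 1)) hpt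
  rw [integral_add' hli ((hI A hAm _).add (hI Aᶜ hAm.compl _)),
    integral_add' (hI A hAm _) (hI Aᶜ hAm.compl _),
    integral_sub' ((hJ A hAm t).add (hJ Aᶜ hAm.compl s)) (integrable_const 1),
    integral_add' (hJ A hAm t) (hJ Aᶜ hAm.compl s), integral_const_mul, integral_const_mul,
    integral_indicator_const _ hAm, integral_indicator_const _ hAm.compl,
    integral_indicator hAm, integral_indicator hAm.compl, hAint, hcint, hlog,
    probReal_compl_eq_one_sub hAm] at hmono
  simp only [smul_eq_mul, integral_const, probReal_univ, mul_one] at hmono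
  linarith

end Simulation

/-- The squared Hellinger distance is at most the relative entropy; only the term of the outcome `1`
is kept on the left. -/
lemma sq_sqrt_sub_sqrt_le_entropy {a b : ℝ} (ha : a ∈ Set.Ioo (0 : ℝ) 1)
    (hb : b ∈ Set.Ioo (0 : ℝ) 1) :
    (√a - √b) ^ 2 ≤ a * Real.log (a / b) + (1 - a) * Real.log ((1 - a) / (1 - b)) := by
  have key {x y : ℝ} (hx : 0 < x) (hy : 0 < y) : 2 * x - 2 * (√x * √y) ≤ x * Real.log (x / y) := by
    have h1 : Real.log (x / y) = -2 * Real.log (√y / √x) := by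
      rw [Real.log_div hx.ne' hy.ne', Real.log_div (by positivity) (by positivity),
        Real.log_sqrt hx.le, Real.log_sqrt hy.le]
      ring
    have h2 : Real.log (√y / √x) ≤ √y / √x - 1 := Real.log_le_sub_one_of_pos (by positivity)
    have h3 : x * (√y / √x) = √x * √y := by
      have : 0 < √x := Real.sqrt_pos.2 hx
      field_simp
      rw [Real.sq_sqrt hx.le]
    rw [h1]
    nlinarith [mul_le_mul_of_nonneg_left h2 hx.le]
  have h1 := key ha.1 hb.1
  have h2 := key (sub_pos.2 ha.2) (sub_pos.2 hb.2)
  have e1 := Real.sq_sqrt ha.1.le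
  have e2 := Real.sq_sqrt hb.1.le
  have e3 := Real.sq_sqrt (sub_pos.2 ha.2).le
  have e4 := Real.sq_sqrt (sub_pos.2 hb.2).le
  nlinarith [sq_nonneg (√(1 - a) - √(1 - b))]

/-- Comparison of the output distributions under two parameters: the relative
entropy of the outputs is at most that of the inputs used, hence at most `E[N]` times the
`χ²`-divergence of single inputs. -/
lemma Simulation.sq_sqrt_sub_sqrt_le (B : Simulation) (p q : Param) (hE : B.EN p ≠ ⊤)
    (ha : (law p).real B.outputOne ∈ Set.Ioo (0 : ℝ) 1)
    (hb : (law q).real B.outputOne ∈ Set.Ioo (0 : ℝ) 1) :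
    (√((law p).real B.outputOne) - √((law q).real B.outputOne)) ^ 2 ≤
      (B.EN p).toReal * ((p - q : ℝ) ^ 2 / (q * (1 - q))) := by
  set a := (law p).real B.outputOne
  set b := (law q).real B.outputOne
  have h1 := q.2.1; have h2 : (0 : ℝ) < 1 - q := by linarith [q.2.2]
  have hs : 0 < (1 - a) / (1 - b) := div_pos (sub_pos.2 ha.2) (sub_pos.2 hb.2)
  have ht : 0 < a / b := div_pos ha.1 hb.1
  have hsum (n : ℕ) : ∑ i ∈ Finset.range n, (law p).real {ω | (i : ℕ∞) < B.N ω} ≤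
      (B.EN p).toReal := by
    simp only [Measure.real]
    rw [← ENNReal.toReal_sum fun i _ => measure_ne_top _ _]
    refine ENNReal.toReal_mono hE ?_
    rw [B.EN_eq_tsum]
    exact ENNReal.sum_le_tsum _
  have hn (n : ℕ) : _ ≤ (B.EN p).toReal * ((p - q : ℝ) ^ 2 / (q * (1 - q))) :=
    (B.entropy_le_of_truncated p q n hs ht).trans <|
      (mul_le_mul_of_nonneg_left (neg_logRatioMean_le p q)
        (Finset.sum_nonneg fun _ _ => measureReal_nonneg)).trans
      (mul_le_mul_of_nonneg_right (hsum n) (by positivity))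
  -- In the limit `n → ∞` the choice `t = a / b`, `s = (1 - a) / (1 - b)` is the optimal one.
  have hA := B.tendsto_law_outputOneBy p
  have hB := B.tendsto_law_outputOneBy q
  have hlim := ((((hA.mul_const (Real.log (a / b))).add
    ((hA.const_sub 1).mul_const (Real.log ((1 - a) / (1 - b))))).add_const 1).sub
    (hB.const_mul (a / b))).sub ((hB.const_sub 1).const_mul ((1 - a) / (1 - b)))
  have hle := le_of_tendsto' hlim hn
  change a * _ + (1 - a) * _ + 1 - a / b * b - (1 - a) / (1 - b) * (1 - b) ≤ _ at hle
  rw [div_mul_cancel₀ _ hb.1.ne', div_mul_cancel₀ _ (sub_pos.2 hb.2).ne'] at hle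
  have := sq_sqrt_sub_sqrt_le_entropy ha hb
  linarith

/-! ### The series algorithm -/

/-- The remaining mass `1 - (c_1 + ⋯ + c_n)` of the coefficients. -/
def remainder (c : ℕ → ℝ) (n : ℕ) : ℝ := 1 - ∑ i ∈ Finset.range n, c (i + 1)

lemma remainder_succ (c : ℕ → ℝ) (n : ℕ) : remainder c (n + 1) = remainder c n - c (n + 1) := by
  rw [remainder, remainder, Finset.sum_range_succ]; ring

lemma dCoeff_succ (c : ℕ → ℝ) (n : ℕ) : dCoeff c (n + 1) = c (n + 1) / remainder c n := by
  rw [dCoeff, remainder, Finset.sum_Ico_eq_sum_range]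
  simp [add_comm]

namespace IsSeriesFor

lemma remainder_nonneg {c : ℕ → ℝ} {f : ℝ → ℝ} (h : IsSeriesFor c f) (n : ℕ) : 0 ≤ remainder c n :=
  sub_nonneg.2 (sum_le_hasSum _ (fun i _ => h.nonneg _ (by omega)) h.sum_eq_one)

lemma remainder_le_one {c : ℕ → ℝ} {f : ℝ → ℝ} (h : IsSeriesFor c f) (n : ℕ) :
    remainder c n ≤ 1 :=
  sub_le_self _ (Finset.sum_nonneg fun i _ => h.nonneg _ (by omega))

lemma coeff_le_remainder {c : ℕ → ℝ} {f : ℝ → ℝ} (h : IsSeriesFor c f) (n : ℕ) :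
    c (n + 1) ≤ remainder c n := by
  have := h.remainder_nonneg (n + 1)
  rw [remainder_succ] at this
  linarith

lemma dCoeff_mem {c : ℕ → ℝ} {f : ℝ → ℝ} (h : IsSeriesFor c f) (n : ℕ) :
    dCoeff c (n + 1) ∈ Set.Icc (0 : ℝ) 1 := by
  rw [dCoeff_succ]
  exact ⟨div_nonneg (h.nonneg _ (by omega)) (h.remainder_nonneg n),
    div_le_one_of_le₀ (h.coeff_le_remainder n) (h.remainder_nonneg n)⟩

lemma remainder_mul {c : ℕ → ℝ} {f : ℝ → ℝ} (h : IsSeriesFor c f) (n : ℕ) :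
    remainder c n * (1 - dCoeff c (n + 1)) = remainder c (n + 1) := by
  rw [dCoeff_succ, remainder_succ]
  by_cases h0 : remainder c n = 0
  · -- Once the coefficients are exhausted, all later ones vanish.
    have h1 := h.coeff_le_remainder n
    have h2 := h.nonneg (n + 1) (by omega)
    rw [h0] at h1 ⊢
    linarith
  · field_simp

lemma hasSum_pow {c : ℕ → ℝ} {f : ℝ → ℝ} (h : IsSeriesFor c f) {p : ℝ}
    (hp : p ∈ Set.Ioo (0 : ℝ) 1) :
    HasSum (fun k : ℕ => c (k + 1) * (1 - p) ^ (k + 1)) (1 - f p) := by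
  have hs : Summable (fun k : ℕ => c (k + 1) * (1 - p) ^ (k + 1)) := by
    refine Summable.of_nonneg_of_le (fun k => mul_nonneg (h.nonneg _ (by omega))
      (pow_nonneg (by linarith [hp.2]) _)) (fun k => ?_) h.sum_eq_one.summable
    exact mul_le_of_le_one_right (h.nonneg _ (by omega))
      (pow_le_one₀ (by linarith [hp.2]) (by linarith [hp.1]))
  have := hs.hasSum
  rwa [show ∑' k : ℕ, c (k + 1) * (1 - p) ^ (k + 1) = 1 - f p by
    rw [h.eq_series p hp]; ring] at this

lemma mem_Ioo {c : ℕ → ℝ} {f : ℝ → ℝ} (h : IsSeriesFor c f) {p : ℝ}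
    (hp : p ∈ Set.Ioo (0 : ℝ) 1) : f p ∈ Set.Ioo (0 : ℝ) 1 := by
  have hq : 0 < 1 - p := by linarith [hp.2]
  constructor
  · -- Comparing `(1 - p) ^ k ≤ 1 - p` termwise gives `f p ≥ p`.
    have hle := hasSum_le (fun k => mul_le_mul_of_nonneg_left
      (pow_le_of_le_one hq.le (by linarith [hp.1]) (Nat.succ_ne_zero k))
      (h.nonneg (k + 1) (by omega))) (h.hasSum_pow hp) (h.sum_eq_one.mul_right (1 - p))
    linarith [hp.1]
  · obtain ⟨k, hk⟩ : ∃ k, c (k + 1) ≠ 0 := by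
      by_contra! h0
      have := h.sum_eq_one
      simp only [h0] at this
      exact one_ne_zero (this.unique hasSum_zero)
    have hk' : 0 < c (k + 1) := lt_of_le_of_ne (h.nonneg _ (by omega)) (Ne.symm hk)
    have hterm := le_hasSum (h.hasSum_pow hp) k fun j _ =>
      mul_nonneg (h.nonneg (j + 1) (by omega)) (pow_nonneg hq.le _)
    have : 0 < c (k + 1) * (1 - p) ^ (k + 1) := by positivity
    linarith

/-- Summation by parts: `∑_{n ≥ 0} (1-p)^n (1 - c_1 - ⋯ - c_n) = f(p) / p`. -/
lemma hasSum_pow_mul_remainder {c : ℕ → ℝ} {f : ℝ → ℝ} (h : IsSeriesFor c f) {p : ℝ}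
    (hp : p ∈ Set.Ioo (0 : ℝ) 1) :
    HasSum (fun n : ℕ => (1 - p) ^ n * remainder c n) (f p / p) := by
  have hq : 0 ≤ 1 - p := by linarith [hp.2]
  have hq1 : 1 - p < 1 := by linarith [hp.1]
  have hp0 : p ≠ 0 := hp.1.ne'
  rw [hasSum_iff_tendsto_nat_of_nonneg fun n => mul_nonneg (pow_nonneg hq _) (h.remainder_nonneg n)]
  have hpart (m : ℕ) : ∑ n ∈ Finset.range m, (1 - p) ^ n * remainder c n =
      (1 - (1 - p) ^ m * remainder c m -
        ∑ k ∈ Finset.range m, c (k + 1) * (1 - p) ^ (k + 1)) / p := by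
    rw [eq_div_iff hp0]
    induction m with
    | zero => simp [remainder]
    | succ m ih =>
      rw [Finset.sum_range_succ, Finset.sum_range_succ, add_mul, ih, remainder_succ]
      ring
  simp only [hpart]
  have hz : Tendsto (fun m => (1 - p) ^ m * remainder c m) atTop (𝓝 0) :=
    squeeze_zero (fun m => mul_nonneg (pow_nonneg hq _) (h.remainder_nonneg m))
      (fun m => mul_le_of_le_one_right (pow_nonneg hq _) (h.remainder_le_one m))
      (tendsto_pow_atTop_nhds_zero_of_lt_one hq hq1)
  have := ((hz.const_sub 1).sub (h.hasSum_pow hp).tendsto_sum_nat).div_const p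
  simpa using this

end IsSeriesFor

lemma inputLaw_continue (p : Param) {d : ℝ} (hd : d ∈ Set.Icc (0 : ℝ) 1) :
    (inputLaw p).real {x | x.1 = false ∧ d ≤ x.2} = (1 - p) * (1 - d) := by
  have h : {x : Bool × ℝ | x.1 = false ∧ d ≤ x.2} = {false} ×ˢ Set.Ici d := by ext; simp
  rw [h, inputLaw, measureReal_prod_prod]
  congr 1
  · simp [Param.toUnitInterval]
  · have hv : (volume : Measure ℝ) (Set.Ici d ∩ Set.Ioo 0 1) = ENNReal.ofReal (1 - d) := by
      refine le_antisymm ?_ ?_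
      · rw [← Real.volume_Icc]
        exact measure_mono fun x hx => ⟨hx.1, hx.2.2.le⟩
      · rw [← Real.volume_Ioo]
        exact measure_mono fun x hx => ⟨hx.1.le, hd.1.trans_lt hx.1, hx.2⟩
    rw [Measure.real, uniform01, Measure.restrict_apply measurableSet_Ici, hv,
      ENNReal.toReal_ofReal (by linarith [hd.2])]

lemma seriesAlgorithm_tau_eq_false (c : ℕ → ℝ) (n : ℕ) (ω : Sample) :
    (seriesAlgorithm c).τ n (pref ω n) = false ↔
      (ω n).1 = false ∧ dCoeff c (n + 1) ≤ (ω n).2 := by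
  change (decide ((ω n).2 < dCoeff c (n + 1)) || (ω n).1) = false ↔ _
  rw [Bool.or_eq_false_iff, decide_eq_false_iff_not, not_lt, and_comm]

lemma law_real_lt_N_seriesAlgorithm {c : ℕ → ℝ} {f : ℝ → ℝ} (h : IsSeriesFor c f) (p : Param)
    (n : ℕ) :
    (law p).real {ω | (n : ℕ∞) < (seriesAlgorithm c).N ω} = (1 - p : ℝ) ^ n * remainder c n := by
  induction n with
  | zero =>
    have : {ω | ((0 : ℕ) : ℕ∞) < (seriesAlgorithm c).N ω} = Set.univ := by
      ext ω; simp only [Set.mem_ofPred_eq, Set.mem_univ, iff_true, Simulation.lt_N_iff]; simp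
    rw [this]
    simp [remainder]
  | succ n ih =>
    have hset : {ω | ((n + 1 : ℕ) : ℕ∞) < (seriesAlgorithm c).N ω} =
        {ω | (n : ℕ∞) < (seriesAlgorithm c).N ω} ∩
          {ω : Sample | ω n ∈ {x : Bool × ℝ | x.1 = false ∧ dCoeff c (n + 1) ≤ x.2}} := by
      ext ω
      simp only [Set.mem_ofPred_eq, Set.mem_inter_iff, Simulation.lt_N_iff,
        ← seriesAlgorithm_tau_eq_false, Nat.lt_succ_iff_lt_or_eq, or_imp, forall_and,
        forall_eq]
    have hT : MeasurableSet {x : Bool × ℝ | x.1 = false ∧ dCoeff c (n + 1) ≤ x.2} :=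
      (measurable_fst (.singleton false)).inter (measurable_snd measurableSet_Ici)
    rw [hset, law_real_inter_apply p n (Simulation.measurableSet_lt_N _ le_rfl) hT, ih,
      inputLaw_continue p (h.dCoeff_mem n), ← h.remainder_mul n]
    ring

lemma seriesAlgorithm_isFast {c : ℕ → ℝ} {f : ℝ → ℝ} (h : IsSeriesFor c f) :
    (seriesAlgorithm c).IsFast := by
  intro p
  refine ⟨1, one_pos, 1 - p, by linarith [p.2.1], fun n => ?_⟩
  rw [law_real_lt_N_seriesAlgorithm h, one_mul]
  exact mul_le_of_le_one_right (pow_nonneg (by linarith [p.2.2]) _) (h.remainder_le_one n)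

lemma seriesAlgorithm_EN {c : ℕ → ℝ} {f : ℝ → ℝ} (h : IsSeriesFor c f) (p : Param) :
    (seriesAlgorithm c).EN p = ENNReal.ofReal (f p / p) := by
  have hs := h.hasSum_pow_mul_remainder p.2
  rw [Simulation.EN_eq_tsum, ← hs.tsum_eq, ENNReal.ofReal_tsum_of_nonneg (fun n => ?_) hs.summable]
  · refine tsum_congr fun n => ?_
    rw [← law_real_lt_N_seriesAlgorithm h, ofReal_measureReal]
  · rw [← law_real_lt_N_seriesAlgorithm h]; exact measureReal_nonneg

lemma Simulation.ae_N_ne_top (B : Simulation) (p : Param) (hE : B.EN p ≠ ⊤) :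
    ∀ᵐ ω ∂law p, B.N ω ≠ ⊤ := by
  have hm : Measurable fun ω => (B.N ω : ℝ≥0∞) := by
    simp only [Simulation.coe_N_eq_tsum]
    exact Measurable.tsum fun n => measurable_one.indicator (B.measurableSet_lt_N_ambient n)
  filter_upwards [ae_lt_top hm hE] with ω hω htop
  simp [htop] at hω

lemma seriesAlgorithm_isFactory {c : ℕ → ℝ} {f : ℝ → ℝ} (h : IsSeriesFor c f) :
    (seriesAlgorithm c).IsFactory f := by
  intro p
  have hE : (seriesAlgorithm c).EN p ≠ ⊤ := by
    rw [seriesAlgorithm_EN h]; exact ENNReal.ofReal_ne_top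
  refine ⟨Simulation.ae_N_ne_top _ p hE, ?_⟩
  set A := seriesAlgorithm c
  have hpiece (n : ℕ) : A.outputOne ∩ {ω | A.N ω = ((n + 1 : ℕ) : ℕ∞)} =
      {ω | (n : ℕ∞) < A.N ω} ∩ {ω : Sample | ω n ∈ {x : Bool × ℝ | x.1 = true}} := by
    ext ω
    have hγ (m : ℕ) : A.γ m (pref ω m) = (ω m).1 := rfl
    simp only [Simulation.outputOne, Set.mem_inter_iff, Set.mem_ofPred_eq, hγ]
    constructor
    · rintro ⟨⟨m, hm, hx⟩, hn⟩
      have : m = n := by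
        have := hm.symm.trans hn
        rw [Nat.cast_inj] at this; omega
      subst this
      exact ⟨((A.N_eq_succ_iff m ω).1 hn).1, hx⟩
    · rintro ⟨hn, hx⟩
      have hN : A.N ω = ((n + 1 : ℕ) : ℕ∞) := by
        refine (A.N_eq_succ_iff n ω).2 ⟨hn, ?_⟩
        by_contra hτ
        have := (seriesAlgorithm_tau_eq_false c n ω).1 (by simpa using hτ)
        simp [this.1] at hx
      exact ⟨⟨n, hN, hx⟩, hN⟩
  have hlaw (n : ℕ) : law p (A.outputOne ∩ {ω | A.N ω = ((n + 1 : ℕ) : ℕ∞)}) =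
      ENNReal.ofReal ((1 - p : ℝ) ^ n * remainder c n * p) := by
    rw [← law_real_lt_N_seriesAlgorithm h, ← inputLaw_true p,
      ← law_real_inter_apply p n (Simulation.measurableSet_lt_N _ le_rfl)
        (T := {x | x.1 = true}) (measurable_fst (.singleton true)), ofReal_measureReal, hpiece]
  have hdisj : Pairwise (Function.onFun Disjoint
      fun n : ℕ => A.outputOne ∩ {ω | A.N ω = ((n + 1 : ℕ) : ℕ∞)}) := by
    intro m n hmn
    refine Set.disjoint_left.2 fun ω hm hn => hmn ?_
    have : ((m + 1 : ℕ) : ℕ∞) = ((n + 1 : ℕ) : ℕ∞) := hm.2.symm.trans hn.2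
    rw [Nat.cast_inj] at this; omega
  have hs := (h.hasSum_pow_mul_remainder p.2).mul_right (p : ℝ)
  rw [div_mul_cancel₀ _ p.2.1.ne'] at hs
  rw [Measure.real, A.outputOne_eq_iUnion, measure_iUnion hdisj fun n =>
    prefixAlgebra_le _ _ (A.measurableSet_N_eq_inter_outputOne n)]
  simp only [hlaw]
  rw [← ENNReal.ofReal_tsum_of_nonneg (fun n => mul_nonneg (mul_nonneg
      (pow_nonneg (by linarith [p.2.2]) _) (h.remainder_nonneg n)) p.2.1.le) hs.summable,
    hs.tsum_eq, ENNReal.toReal_ofReal (h.mem_Ioo p.2).1.le]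

/-! ### The lower bound on the average number of inputs -/

/-- The Cramér–Rao-type bound: the derivative of `√f` at `p` is controlled by the Fisher information
`1 / (p (1 - p))` of one input times the average number of inputs. -/
lemma Simulation.IsFactory.sq_deriv_le {B : Simulation} {f : ℝ → ℝ} (hB : B.IsFactory f)
    (hf : ∀ q ∈ Set.Ioo (0 : ℝ) 1, f q ∈ Set.Ioo (0 : ℝ) 1) (p : Param) (hE : B.EN p ≠ ⊤)
    (hd : DifferentiableAt ℝ f p) :
    (deriv f p / (2 * √(f p))) ^ 2 ≤ (B.EN p).toReal * (1 / (p * (1 - p))) := by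
  have hg : HasDerivAt (fun q => √(f q)) (deriv f p / (2 * √(f p))) p :=
    hd.hasDerivAt.sqrt (hf p p.2).1.ne'
  have hslope := (hasDerivAt_iff_tendsto_slope.1 hg).pow 2
  have hp : (p : ℝ) * (1 - p) ≠ 0 := mul_ne_zero p.2.1.ne' (by linarith [p.2.2])
  have hright : Tendsto (fun q : ℝ => (B.EN p).toReal * (1 / (q * (1 - q)))) (𝓝[≠] (p : ℝ))
      (𝓝 ((B.EN p).toReal * (1 / (p * (1 - p))))) := by
    have hc : ContinuousAt (fun q : ℝ => (B.EN p).toReal * (1 / (q * (1 - q)))) p :=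
      continuousAt_const.mul (continuousAt_const.div (by fun_prop) hp)
    exact hc.tendsto.mono_left nhdsWithin_le_nhds
  refine le_of_tendsto_of_tendsto hslope hright ?_
  filter_upwards [self_mem_nhdsWithin, nhdsWithin_le_nhds (isOpen_Ioo.mem_nhds p.2)] with q hne hq
  have h := B.sq_sqrt_sub_sqrt_le p ⟨q, hq⟩ hE
  rw [(hB p).2, (hB ⟨q, hq⟩).2] at h
  have h' := h (hf p p.2) (hf q hq)
  have hqp : 0 < (q - p : ℝ) ^ 2 := sq_pos_of_ne_zero (sub_ne_zero.2 hne)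
  rw [slope_def_field, div_pow, div_le_iff₀ hqp]
  calc (√(f q) - √(f p)) ^ 2 = (√(f p) - √(f q)) ^ 2 := by ring
    _ ≤ _ := h'
    _ = _ := by ring

/-- If `f' = Ω(f/p)`, every Bernoulli factory for `f` uses `Ω(f(p)/p)` inputs on average. -/
lemma Simulation.IsFactory.exists_le_EN {B : Simulation} {f : ℝ → ℝ} (hB : B.IsFactory f)
    (hf : ∀ q ∈ Set.Ioo (0 : ℝ) 1, f q ∈ Set.Ioo (0 : ℝ) 1)
    (hderiv : IsOmegaAtZero (deriv f) (fun p => f p / p)) :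
    ∃ C : ℝ, 0 < C ∧ ∃ δ : ℝ, 0 < δ ∧
      ∀ p : Param, (p : ℝ) < δ → ENNReal.ofReal (C * (f p / p)) ≤ B.EN p := by
  obtain ⟨C₀, hC₀, δ₀, hδ₀, hle⟩ := hderiv
  -- The factor `1/8` is the `1/4` from the derivative of `√f` times the bound `1 - p ≥ 1/2`.
  refine ⟨C₀ ^ 2 / 8, by positivity, min δ₀ (1 / 2), by positivity, fun p hp => ?_⟩
  by_cases hE : B.EN p = ⊤
  · simp [hE]
  have h1 := p.2.1
  have h2 : (p : ℝ) < 1 / 2 := hp.trans_le (min_le_right _ _)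
  have h3 : (0 : ℝ) < 1 - p := by linarith
  have hfp := (hf p p.2).1
  have hd0 : C₀ * (f p / p) ≤ deriv f p := hle p p.2 (hp.trans_le (min_le_left _ _))
  have hpos : 0 < C₀ * (f p / p) := by positivity
  have hkey := hB.sq_deriv_le hf p hE
    (differentiableAt_of_deriv_ne_zero (hpos.trans_le hd0).ne')
  rw [div_pow, mul_pow, Real.sq_sqrt hfp.le] at hkey
  refine ENNReal.ofReal_le_of_le_toReal ?_
  have hsq : (C₀ * (f p / p)) ^ 2 ≤ deriv f p ^ 2 := pow_le_pow_left₀ hpos.le hd0 2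
  have hchain : (C₀ * (f p / p)) ^ 2 / (2 ^ 2 * f p) ≤
      (B.EN p).toReal * (1 / (p * (1 - p))) :=
    (div_le_div_of_nonneg_right hsq (by positivity)).trans hkey
  have e1 : (C₀ * (f p / p)) ^ 2 / (2 ^ 2 * f p) * (p * (1 - p)) =
      C₀ ^ 2 / 4 * (f p / p) * (1 - p) := by
    field_simp; ring
  have e2 : (B.EN p).toReal * (1 / (p * (1 - p))) * (p * (1 - p)) = (B.EN p).toReal := by
    field_simp
  have h4 := mul_le_mul_of_nonneg_right hchain (mul_pos h1 h3).le
  rw [e1, e2] at h4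
  have h5 : 0 < C₀ ^ 2 / 4 * (f p / p) := by positivity
  nlinarith

end BernoulliFactory

open BernoulliFactory in
theorem mainTheorem1 (c : ℕ → ℝ) (f : ℝ → ℝ) (hcf : IsSeriesFor c f)
    (hlim : Tendsto (fun p : ℝ => f p / p) (𝓝[>] 0) atTop)
    (hderiv : IsOmegaAtZero (deriv f) (fun p => f p / p)) :
    IsAsymptoticallyOptimal (seriesAlgorithm c) f ∧
    (∀ p : Param, (seriesAlgorithm c).EN p = ENNReal.ofReal (f p / p)) ∧
    ∀ B : Simulation, B.IsFactory f → B.IsFast →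
      ∃ C : ℝ, 0 < C ∧ ∃ δ : ℝ, 0 < δ ∧
        ∀ p : Param, (p : ℝ) < δ → ENNReal.ofReal (C * (f p / p)) ≤ B.EN p := by
  have hlower (B : Simulation) (hB : B.IsFactory f) :=
    hB.exists_le_EN (fun _ hq => hcf.mem_Ioo hq) hderiv
  refine ⟨⟨seriesAlgorithm_isFactory hcf, seriesAlgorithm_isFast hcf, fun B hB _ => ?_⟩,
    seriesAlgorithm_EN hcf, fun B hB _ => hlower B hB⟩
  obtain ⟨C, hC, δ, hδ, h⟩ := hlower B hB
  refine ⟨C, hC, δ, hδ, fun p hp => ?_⟩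
  rw [seriesAlgorithm_EN hcf, ← ENNReal.ofReal_mul hC.le]
  exact h p hp
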